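/- Let $n\ge 2$ be an integer and let $T\in M_n(\mathbb C)$. The following are equivalent. (a) There exist $M,N\in M_n(\mathbb C)$ with $M^2=0=N^2$ and $T=MN-NM$. (b) There exist an integer $k$ with $0\le 2k\le n$, an invertible matrix $A\in M_k(\mathbb C)$ and a nilpotent matrix $L\in M_{n-2k}(\mathbb C)$ such that $T$ is similar to the block diagonal matrix $(A\oplus -A)\oplus L^2$. Here a summand of size $0$ (the case $k=0$ or $2k=n$) is absent, and two matrices $S,S'\in M_n(\mathbb C)$ are similar if $S=PS'P^{-1}$ for some invertible $P\in M_n(\mathbb C)$. -/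

import Mathlib

/-- `T` is a commutator `M N - N M` of two matrices with `M ^ 2 = 0` and `N ^ 2 = 0`. -/
def IsSquareZeroCommutator {ι : Type*} [Fintype ι] [DecidableEq ι] (T : Matrix ι ι ℂ) : Prop :=
  ∃ M N : Matrix ι ι ℂ, M ^ 2 = 0 ∧ N ^ 2 = 0 ∧ T = M * N - N * M

/-- Similarity of square matrices whose rows and columns are labelled by possibly different finite
types: `S = P T P⁻¹` for an invertible `P`, with `Q` the two-sided inverse of `P`. -/
def MatrixSimilar {ι κ : Type*} [Fintype ι] [DecidableEq ι] [Fintype κ] [DecidableEq κ]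
    (S : Matrix ι ι ℂ) (T : Matrix κ κ ℂ) : Prop :=
  ∃ (P : Matrix ι κ ℂ) (Q : Matrix κ ι ℂ), P * Q = 1 ∧ Q * P = 1 ∧ S = P * T * Q

/-- The direct sum of two square matrices, as a block diagonal matrix. -/
def matrixDirectSum {ι κ : Type*} (A : Matrix ι ι ℂ) (B : Matrix κ κ ℂ) :
    Matrix (ι ⊕ κ) (ι ⊕ κ) ℂ :=
  Matrix.fromBlocks A 0 0 B

/-! Put `E = M * N + N * M` and `X = M + N`. Since M and N square to zero, `X ^ 2 = E`, E commutes
with M and N, the commutator T anticommutes with X, and `T ^ 2 = E ^ 2`. The Fitting decomposition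
of E splits the space. Where E is invertible, it is the sum of the subspaces `T = E` and `T = -E`,
which X exchanges: this gives A ⊕ -A.

On the other summand T is nilpotent, and it must be shown to be a square. List its Jordan chains by
decreasing length and pair consecutive ones. A pair whose lengths differ by at most 1 can be
interleaved into a square root. A gap of 2 or more would give two successive layers `ker T^(j+1) /
ker T^j` of the same odd dimension, which `even_finrank_ker_pow_layer` excludes by a homology
argument.

Conversely, A ⊕ -A is a commutator of off-diagonal blocks, and L² is one of signed shifts along the
Jordan chains of L. -/

/-! ### Jordan chains of a nilpotent endomorphism -/

open Module Polynomial in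
/-- A nilpotent endomorphism has a basis made of Jordan chains. -/
theorem exists_jordan_chains {K V : Type*} [Field K] [AddCommGroup V] [Module K V]
    [FiniteDimensional K V] (T : End K V) (hT : IsNilpotent T) :
    ∃ (d : ℕ) (k : Fin d → ℕ) (x : Fin d → V) (b : Basis (Σ i, Fin (k i)) K V),
      (∀ p, b p = (T ^ (p.2 : ℕ)) (x p.1)) ∧ ∀ i, (T ^ k i) (x i) = 0 := by
  classical
  obtain ⟨m, hm⟩ := hT
  have htor : Module.IsTorsion' (AEval' T) (Submonoid.powers (X : K[X])) := by
    intro v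
    refine ⟨⟨X ^ m, m, rfl⟩, ?_⟩
    obtain ⟨w, rfl⟩ := (AEval'.of T).surjective v
    change (X ^ m : K[X]) • AEval'.of T w = 0
    rw [AEval'.X_pow_smul_of, hm]
    simp
  obtain ⟨d, k, ⟨e⟩⟩ := Module.torsion_by_prime_power_decomposition
    (Polynomial.irreducible_X (R := K)) htor
  -- The chain heads are the generators of the cyclic summands `K[X] / (X ^ k i)`.
  let g (i : Fin d) : AEval' T := e.symm (DirectSum.lof K[X] _ _ i (Submodule.Quotient.mk 1))
  let x (i : Fin d) : V := (AEval'.of T).symm (g i)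
  have hxg (p : K[X]) (i : Fin d) : AEval'.of T (aeval T p (x i)) = p • g i := by
    have := AEval.of_aeval_smul (R := K) (a := T) p (x i)
    rw [show x i = (AEval'.of T).symm (g i) from rfl] at this ⊢
    exact this.trans (by congr 1)
  have hge (p : K[X]) (i : Fin d) :
      e (p • g i) = DirectSum.lof K[X] _ _ i (Submodule.Quotient.mk p) := by
    rw [map_smul]
    simp only [g, LinearEquiv.apply_symm_apply]
    rw [← map_smul, ← Submodule.Quotient.mk_smul, smul_eq_mul, mul_one]
  have hx0 (i : Fin d) : (T ^ k i) (x i) = 0 := by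
    apply (AEval'.of T).injective
    have := hxg (X ^ k i) i
    rw [map_pow, aeval_X] at this
    rw [this, map_zero]
    apply e.injective
    rw [hge, map_zero, (Submodule.Quotient.mk_eq_zero _).2 (Submodule.mem_span_singleton_self _),
      map_zero]
  let v (p : Σ i, Fin (k i)) : V := (T ^ (p.2 : ℕ)) (x p.1)
  have hli : LinearIndependent K v := by
    rw [Fintype.linearIndependent_iff]
    intro c hc
    let P (i : Fin d) : K[X] := ∑ l : Fin (k i), C (c ⟨i, l⟩) * X ^ (l : ℕ)
    have hP (i : Fin d) : aeval T (P i) (x i) = ∑ l : Fin (k i), c ⟨i, l⟩ • v ⟨i, l⟩ := by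
      simp [P, v, LinearMap.sum_apply, Module.algebraMap_end_apply]
    have hsum : ∑ i, P i • g i = 0 := by
      simp_rw [← hxg, hP, ← map_sum]
      rw [← Fintype.sum_sigma' (fun i (l : Fin (k i)) => c ⟨i, l⟩ • v ⟨i, l⟩)]
      erw [hc]
      exact map_zero _
    rintro ⟨i, l⟩
    have h0 : (Submodule.Quotient.mk (P i) : K[X] ⧸ Submodule.span K[X] {(X : K[X]) ^ k i}) = 0 := by
      have h1 := congrArg (fun z => DirectSum.component K[X] _ _ i (e z)) hsum
      simp only [map_sum, hge, map_zero] at h1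
      rw [Finset.sum_eq_single i] at h1
      · rwa [DirectSum.component.lof_self] at h1
      · intro j _ hj
        rw [DirectSum.component.of, dif_neg hj]
      · simp
    rw [Submodule.Quotient.mk_eq_zero, Submodule.mem_span_singleton] at h0
    obtain ⟨q, hq⟩ := h0
    have hc1 : (P i).coeff l = 0 := by
      rw [← hq, smul_eq_mul, Polynomial.coeff_mul_X_pow', if_neg (by omega)]
    have hc2 : (P i).coeff l = c ⟨i, l⟩ := by
      simp only [P, finsetSum_coeff, coeff_C_mul, coeff_X_pow]
      rw [Finset.sum_eq_single l]
      · simp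
      · intro j _ hj
        rw [if_neg (fun h => hj (Fin.ext h.symm)), mul_zero]
      · simp
    rw [← hc2, hc1]
  have hspan : ⊤ ≤ Submodule.span K (Set.range v) := by
    have hmem (i : Fin d) (l : ℕ) : (T ^ l) (x i) ∈ Submodule.span K (Set.range v) := by
      by_cases hl : l < k i
      · exact Submodule.subset_span ⟨⟨i, l, hl⟩, rfl⟩
      · obtain ⟨j, rfl⟩ := Nat.exists_eq_add_of_le (not_lt.1 hl)
        rw [add_comm, pow_add, Module.End.mul_apply, hx0, map_zero]
        exact zero_mem _
    have hmemP (i : Fin d) (p : K[X]) : aeval T p (x i) ∈ Submodule.span K (Set.range v) := by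
      rw [aeval_eq_sum_range, LinearMap.sum_apply]
      exact Submodule.sum_mem _ fun j _ => by
        rw [LinearMap.smul_apply]; exact Submodule.smul_mem _ _ (hmem i j)
    have key (z : DirectSum (Fin d) fun i => K[X] ⧸ Submodule.span K[X] {(X : K[X]) ^ k i}) :
        (AEval'.of T).symm (e.symm z) ∈ Submodule.span K (Set.range v) := by
      induction z using DirectSum.induction_on with
      | zero => simp
      | of i y =>
        obtain ⟨p, rfl⟩ := Submodule.Quotient.mk_surjective _ y
        have : e.symm (DirectSum.lof K[X] _ _ i (Submodule.Quotient.mk p)) = p • g i := by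
          rw [← hge, LinearEquiv.symm_apply_apply]
        have h2 : (AEval'.of T).symm (p • g i) = aeval T p (x i) := by
          rw [← hxg, LinearEquiv.symm_apply_apply]
        have h3 := hmemP i p
        rw [← h2, ← this] at h3
        exact h3
      | add y z hy hz => rw [map_add, map_add]; exact add_mem hy hz
    intro w _
    have := key (e (AEval'.of T w))
    rwa [LinearEquiv.symm_apply_apply, LinearEquiv.symm_apply_apply] at this
  exact ⟨d, k, x, Basis.mk hli hspan, fun p => by rw [Basis.mk_apply], hx0⟩

open Module in
/-- The Jordan chains can be listed by decreasing length; beyond the last one they have length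
zero. -/
theorem exists_antitone_jordan_chains {K V : Type*} [Field K] [AddCommGroup V] [Module K V]
    [FiniteDimensional K V] (T : End K V) (hT : IsNilpotent T) :
    ∃ (d : ℕ) (k : ℕ → ℕ) (x : ℕ → V) (b : Basis (Σ i : Fin d, Fin (k i)) K V),
      Antitone k ∧ (∀ i, d ≤ i → k i = 0) ∧ (∀ p, b p = (T ^ (p.2 : ℕ)) (x p.1)) ∧
        ∀ i, (T ^ k i) (x i) = 0 := by
  obtain ⟨d, k, x, b, hb, hx⟩ := exists_jordan_chains T hT
  let σ : Equiv.Perm (Fin d) := Tuple.sort (fun i => OrderDual.toDual (k i))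
  have hσ : Antitone (k ∘ σ) := fun i j hij =>
    Tuple.monotone_sort (fun i => OrderDual.toDual (k i)) hij
  -- The value 0 beyond `d` lets the last chain be paired with an empty one when `d` is odd.
  let k' (i : ℕ) : ℕ := if h : i < d then k (σ ⟨i, h⟩) else 0
  let x' (i : ℕ) : V := if h : i < d then x (σ ⟨i, h⟩) else 0
  have hk' (i : Fin d) : k' i = k (σ i) := by simp [k']
  have hx' (i : Fin d) : x' i = x (σ i) := by simp [x']
  let e : (Σ i : Fin d, Fin (k' i)) ≃ Σ i : Fin d, Fin (k i) :=
    (Equiv.sigmaCongrRight fun i => finCongr (hk' i)).trans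
      (Equiv.sigmaCongrLeft (β := fun i => Fin (k i)) σ)
  refine ⟨d, k', x', b.reindex e.symm, ?_, ?_, ?_, ?_⟩
  · intro i j hij
    by_cases hj : j < d
    · have hi : i < d := by omega
      simp only [k', dif_pos hj, dif_pos hi]
      exact hσ (show (⟨i, hi⟩ : Fin d) ≤ ⟨j, hj⟩ from hij)
    · simp [k', hj]
  · intro i hi
    simp [k', not_lt.2 hi]
  · rintro ⟨i, l⟩
    rw [Basis.reindex_apply, Equiv.symm_symm, hb, hx']
    rfl
  · intro i
    by_cases hi : i < d
    · simp only [k', x', dif_pos hi]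
      exact hx _
    · simp [x', hi]

/-! ### Parity of the layers of the kernel filtration -/

-- Rank-nullity for the map `p → V ⧸ q` induced by `f`.
open Module Submodule in
theorem finrank_eq_finrank_inf_comap_add {K V : Type*} [Field K] [AddCommGroup V] [Module K V]
    [FiniteDimensional K V] (f : End K V) (p q : Submodule K V) :
    finrank K p + finrank K q =
      finrank K (p ⊓ q.comap f : Submodule K V) + finrank K (p.map f ⊔ q : Submodule K V) := by
  let φ : p →ₗ[K] V ⧸ q := q.mkQ ∘ₗ f ∘ₗ p.subtype
  have h1 := φ.finrank_range_add_finrank_ker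
  have hker : (LinearMap.ker φ).map p.subtype = p ⊓ q.comap f := by
    ext v
    simp [φ, LinearMap.mem_ker, and_comm]
  have hrange : LinearMap.range φ = (p.map f ⊔ q).map q.mkQ := by
    rw [Submodule.map_sup, Submodule.mkQ_map_self, sup_bot_eq]
    simp [φ, LinearMap.range_comp]
  have h2 : finrank K (LinearMap.ker φ) = finrank K (p ⊓ q.comap f : Submodule K V) := by
    rw [← hker]
    exact (LinearEquiv.finrank_eq (Submodule.equivMapOfInjective _ p.injective_subtype _))
  let ψ : (p.map f ⊔ q : Submodule K V) →ₗ[K] V ⧸ q := q.mkQ ∘ₗ (p.map f ⊔ q).subtype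
  have h3 := ψ.finrank_range_add_finrank_ker
  have hrange' : LinearMap.range ψ = (p.map f ⊔ q).map q.mkQ := by
    simp [ψ, LinearMap.range_comp]
  have hker' : (LinearMap.ker ψ).map (p.map f ⊔ q).subtype = q := by
    ext v
    simp only [ψ, LinearMap.mem_ker, Submodule.mem_map, LinearMap.comp_apply, mkQ_apply,
      Submodule.Quotient.mk_eq_zero, subtype_apply]
    exact ⟨fun ⟨w, hw, h⟩ => h ▸ hw, fun h => ⟨⟨v, mem_sup_right h⟩, h, rfl⟩⟩
  have h4 : finrank K (LinearMap.ker ψ) = finrank K q := by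
    conv_rhs => rw [← hker']
    exact (LinearEquiv.finrank_eq (Submodule.equivMapOfInjective _ (Submodule.injective_subtype _) _))
  rw [hrange, h2] at h1
  rw [hrange', h4] at h3
  omega

section Commutator

variable {K V : Type*} [Field K] [AddCommGroup V] [Module K V] {M N : Module.End K V}

theorem mul_commutator_of_sq_eq_zero {R : Type*} [Ring R] {M N : R} (hM : M * M = 0) :
    M * (M * N - N * M) = -((M * N - N * M) * M) := by
  rw [mul_sub, sub_mul, ← mul_assoc, hM, mul_assoc N, hM]
  simp [mul_assoc]

theorem commutator_mul_of_sq_eq_zero {R : Type*} [Ring R] {M N : R} (hN : N * N = 0) :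
    N * (M * N - N * M) = -((M * N - N * M) * N) := by
  rw [mul_sub, sub_mul, ← mul_assoc N N M, hN, mul_assoc M N N, hN]
  simp [mul_assoc]

theorem ker_pow_le_comap_of_anticommute {T S : Module.End K V} (h : S * T = -(T * S)) (j : ℕ) :
    LinearMap.ker (T ^ j) ≤ (LinearMap.ker (T ^ j)).comap S := by
  intro v hv
  have hc : T * S = (-S) * T := by rw [neg_mul, h, neg_neg]
  -- The scalar is the sign `(-1) ^ j`; only its existence matters.
  have key : ∀ j : ℕ, ∃ ε : K, T ^ j * S = ε • (S * T ^ j) := by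
    intro j
    induction j with
    | zero => exact ⟨1, by simp⟩
    | succ j ih =>
      obtain ⟨ε, hε⟩ := ih
      refine ⟨-ε, ?_⟩
      rw [pow_succ', mul_assoc, hε, mul_smul_comm, ← mul_assoc, hc, neg_mul, neg_mul, smul_neg,
        neg_smul, mul_assoc]
  obtain ⟨ε, hε⟩ := key j
  rw [Submodule.mem_comap, LinearMap.mem_ker, ← Module.End.mul_apply, hε, LinearMap.smul_apply,
    Module.End.mul_apply, LinearMap.mem_ker.1 hv, map_zero, smul_zero]

open Module in
/-- If the dimensions of two successive layers of the kernel filtration of a commutator of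
square-zero endomorphisms agree, they are even. -/
theorem even_finrank_ker_pow_layer [FiniteDimensional K V] (hM : M * M = 0) (hN : N * N = 0)
    {T : End K V} (hT : T = M * N - N * M) (j δ : ℕ)
    (h1 : finrank K (LinearMap.ker (T ^ (j + 1))) = finrank K (LinearMap.ker (T ^ j)) + δ)
    (h2 : finrank K (LinearMap.ker (T ^ (j + 2))) = finrank K (LinearMap.ker (T ^ (j + 1))) + δ) :
    Even δ := by
  have hMT : M * T = -(T * M) := hT ▸ mul_commutator_of_sq_eq_zero hM
  have hNT : N * T = -(T * N) := hT ▸ commutator_mul_of_sq_eq_zero hN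
  have hMT' (v : V) : M (T v) = -T (M v) := LinearMap.congr_fun hMT v
  have hNT' (v : V) : N (T v) = -T (N v) := LinearMap.congr_fun hNT v
  have hM' (v : V) : M (M v) = 0 := LinearMap.congr_fun hM v
  have hN' (v : V) : N (N v) = 0 := LinearMap.congr_fun hN v
  have hT' (v : V) : T v = M (N v) - N (M v) := by rw [hT]; rfl
  set Z := LinearMap.ker (T ^ j) with hZ
  set A := LinearMap.ker (T ^ (j + 1)) with hA
  set F := LinearMap.ker (T ^ (j + 2)) with hF
  have hAT : A = Z.comap T := by ext v; simp [hA, hZ, pow_succ]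
  have hFT : F = A.comap T := by
    ext v; rw [hF, hA, show j + 2 = (j + 1) + 1 from rfl]; simp [pow_succ]
  have hZA : Z ≤ A := fun v hv => by
    rw [hA, LinearMap.mem_ker, pow_succ', Module.End.mul_apply, LinearMap.mem_ker.1 hv, map_zero]
  have hAF : A ≤ F := fun v hv => by
    rw [hF, LinearMap.mem_ker, pow_succ' T (j + 1), Module.End.mul_apply, LinearMap.mem_ker.1 hv,
      map_zero]
  have hMZ : ∀ v ∈ Z, M v ∈ Z := ker_pow_le_comap_of_anticommute hMT j
  have hNZ : ∀ v ∈ Z, N v ∈ Z := ker_pow_le_comap_of_anticommute hNT j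
  have hMA : ∀ v ∈ A, M v ∈ A := ker_pow_le_comap_of_anticommute hMT (j + 1)
  have hNA : ∀ v ∈ A, N v ∈ A := ker_pow_le_comap_of_anticommute hNT (j + 1)
  have hTA (v : V) : v ∈ A ↔ T v ∈ Z := by rw [hAT]; rfl
  have hTF (v : V) : v ∈ F ↔ T v ∈ A := by rw [hFT]; rfl
  -- T induces an injection `F / A → A / Z`; equal dimensions make it onto.
  have hsurj : F.map T ⊔ Z = A := by
    have h := finrank_eq_finrank_inf_comap_add T F Z
    rw [← hAT, inf_eq_right.2 hAF] at h
    refine Submodule.eq_of_le_of_finrank_eq (sup_le ?_ hZA) (by omega)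
    exact Submodule.map_le_iff_le_comap.2 hFT.le
  have hsurj' (w : V) (hw : w ∈ A) : ∃ u z, T u ∈ A ∧ z ∈ Z ∧ w = T u + z := by
    rw [← hsurj] at hw
    obtain ⟨_, ⟨u, hu, rfl⟩, z, hz, rfl⟩ := Submodule.mem_sup.1 hw
    exact ⟨u, z, (hTF u).1 hu, hz, rfl⟩
  -- T vanishes on `A / Z`, so M and N commute there. The quotient `C / B` is the homology of M on
  -- `A / Z`, and N acts on it with square zero.
  set B := A.map M ⊔ Z with hB
  set C := A ⊓ Z.comap M with hC
  have hMB (v : V) (hv : v ∈ A) : M v ∈ B := Submodule.mem_sup_left ⟨v, hv, rfl⟩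
  have hZB : Z ≤ B := le_sup_right
  have e1 := finrank_eq_finrank_inf_comap_add M A Z
  have e2 := finrank_eq_finrank_inf_comap_add N C B
  -- N is exact on `C / B`: if `w = T u + z` and `N w` is `M (T v)` modulo Z, then `w = M (N u - M
  -- v) - N (M u) + z`, with `N u - M v` and `M u` in A. Both `A / Z` modulo its M-homology and that
  -- homology then have even dimension.
  have hexact : C ⊓ B.comap N = C.map N ⊔ B := by
    apply le_antisymm
    · rintro w ⟨⟨hwA, hwM⟩, hwN⟩
      obtain ⟨u, z, hu, hz, rfl⟩ := hsurj' w hwA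
      obtain ⟨_, ⟨y, hy, rfl⟩, z₁, hz₁, hyz⟩ := Submodule.mem_sup.1 (show N (T u + z) ∈ B from hwN)
      obtain ⟨v, z₂, hv, hz₂, rfl⟩ := hsurj' y hy
      have hMu : M u ∈ A := by
        rw [hTA, ← neg_mem_iff, ← hMT']
        have := sub_mem (show M (T u + z) ∈ Z from hwM) (hMZ z hz)
        rwa [map_add, add_sub_cancel_right] at this
      have hNM : N u - M v ∈ A := by
        rw [hTA, ← neg_mem_iff, map_sub, neg_sub, sub_eq_neg_add, ← hNT']
        rw [← sub_eq_zero] at hyz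
        have h : N (T u) + T (M v) = M z₂ + z₁ - N z := by
          have h3 : T (M v) = -M (T v) := by rw [hMT', neg_neg]
          rw [h3, ← sub_eq_zero, ← neg_eq_zero, ← hyz]
          simp only [map_add]
          abel
        rw [h]
        exact sub_mem (add_mem (hMZ _ hz₂) hz₁) (hNZ _ hz)
      have hw : T u + z = M (N u - M v) + (-N (M u) + z) := by
        rw [hT', map_sub, hM' v]
        abel
      rw [hw]
      refine add_mem (Submodule.mem_sup_right (hMB _ hNM))
        (add_mem (neg_mem (Submodule.mem_sup_left ⟨M u, ⟨hMu, ?_⟩, rfl⟩))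
          (Submodule.mem_sup_right (hZB hz)))
      rw [SetLike.mem_coe, Submodule.mem_comap, hM']
      exact zero_mem _
    · refine sup_le ?_ (sup_le ?_ ?_)
      · rintro _ ⟨w, ⟨hwA, hwM⟩, rfl⟩
        refine ⟨⟨hNA w hwA, ?_⟩, ?_⟩
        · have h : M (N w) = T w + N (M w) := by rw [hT']; abel
          rw [SetLike.mem_coe, Submodule.mem_comap, h]
          exact add_mem ((hTA w).1 hwA) (hNZ _ hwM)
        · rw [SetLike.mem_coe, Submodule.mem_comap, hN']
          exact zero_mem _
      · rintro _ ⟨w, hwA, rfl⟩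
        refine ⟨⟨hMA w hwA, ?_⟩, ?_⟩
        · rw [SetLike.mem_coe, Submodule.mem_comap, hM']
          exact zero_mem _
        · have h : N (M w) = M (N w) - T w := by rw [hT']; abel
          rw [SetLike.mem_coe, Submodule.mem_comap, h]
          exact sub_mem (hMB _ (hNA w hwA)) (hZB ((hTA w).1 hwA))
      · exact fun z hz => ⟨⟨hZA hz, hMZ z hz⟩, hZB (hNZ z hz)⟩
  rw [← hB, ← hC] at e1
  rw [hexact] at e2
  have hle := Submodule.finrank_mono (hZB.trans (le_sup_right : B ≤ C.map N ⊔ B))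
  exact ⟨finrank K (C.map N ⊔ B : Submodule K V) - finrank K Z, by omega⟩

end Commutator

/-! ### Nilpotent squares and nilpotent commutators -/

-- The range of `T ^ j` has as basis the chain vectors at positions at least `j`, so a chain
-- contributes its length minus `j`, truncated at 0.
open Module in
theorem finrank_ker_pow_of_jordan_chains {K V : Type*} [Field K] [AddCommGroup V] [Module K V]
    [FiniteDimensional K V] {T : End K V} {d : ℕ} {k : ℕ → ℕ} {x : ℕ → V}
    (b : Basis (Σ i : Fin d, Fin (k i)) K V) (hb : ∀ p, b p = (T ^ (p.2 : ℕ)) (x p.1))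
    (hx : ∀ i, (T ^ k i) (x i) = 0) (j : ℕ) :
    finrank K (LinearMap.ker (T ^ j)) + ∑ i : Fin d, (k i - j) = finrank K V := by
  rw [← (T ^ j).finrank_range_add_finrank_ker, add_comm]
  congr 1
  let f : (Σ i : Fin d, Fin (k i - j)) → Σ i : Fin d, Fin (k i) :=
    fun p => ⟨p.1, ⟨p.2 + j, by omega⟩⟩
  have hf : Function.Injective f := by
    rintro ⟨i, l⟩ ⟨i', l'⟩ h
    simp only [f, Sigma.mk.injEq] at h
    obtain ⟨rfl, h⟩ := h
    simp only [heq_eq_eq, Fin.mk.injEq, add_left_inj] at h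
    rw [Fin.ext h]
  have hli : LinearIndependent K (b ∘ f) := b.linearIndependent.comp f hf
  have hspan : LinearMap.range (T ^ j) = Submodule.span K (Set.range (b ∘ f)) := by
    apply le_antisymm
    · rw [LinearMap.range_eq_map, ← b.span_eq, Submodule.map_span, Submodule.span_le]
      rintro _ ⟨_, ⟨⟨i, l⟩, rfl⟩, rfl⟩
      rw [hb, ← Module.End.mul_apply, ← pow_add, SetLike.mem_coe]
      by_cases h : (l : ℕ) + j < k i
      · refine Submodule.subset_span ⟨⟨i, ⟨l, by omega⟩⟩, ?_⟩
        simp only [Function.comp_apply, f, hb, add_comm]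
      · obtain ⟨m, hm⟩ := Nat.exists_eq_add_of_le (not_lt.1 h)
        rw [show j + (l : ℕ) = m + k i by omega, pow_add, Module.End.mul_apply, hx, map_zero]
        exact zero_mem _
    · rw [Submodule.span_le]
      rintro _ ⟨⟨i, l⟩, rfl⟩
      refine ⟨(T ^ (l : ℕ)) (x i), ?_⟩
      rw [← Module.End.mul_apply, ← pow_add, Function.comp_apply, hb, add_comm]
  rw [hspan, finrank_span_eq_card hli]
  simp

open Module in
/-- A nilpotent endomorphism whose Jordan chains, listed by decreasing length, have almost equal
lengths in each consecutive pair is a square. -/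
theorem exists_sq_eq_of_jordan_chains {K V : Type*} [Field K] [AddCommGroup V] [Module K V]
    {T : End K V} {d : ℕ} {k : ℕ → ℕ} {x : ℕ → V}
    (b : Basis (Σ i : Fin d, Fin (k i)) K V) (hb : ∀ p, b p = (T ^ (p.2 : ℕ)) (x p.1))
    (hx : ∀ i, (T ^ k i) (x i) = 0) (hd : ∀ i, d ≤ i → k i = 0) (hk : Antitone k)
    (hpair : ∀ a, k (2 * a) ≤ k (2 * a + 1) + 1) :
    ∃ L : End K V, L ^ 2 = T := by
  have hzero (i l : ℕ) (h : k i ≤ l) : (T ^ l) (x i) = 0 := by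
    obtain ⟨m, rfl⟩ := Nat.exists_eq_add_of_le h
    rw [add_comm, pow_add, Module.End.mul_apply, hx, map_zero]
  -- Interleaving: `T ^ l x_{2a} ↦ T ^ l x_{2a+1} ↦ T ^ (l+1) x_{2a}`. The bounds on the lengths
  -- keep this formula valid past the ends of the chains.
  let L : End K V := b.constr K fun p =>
    if Even (p.1 : ℕ) then (T ^ (p.2 : ℕ)) (x (p.1 + 1)) else (T ^ (p.2 + 1 : ℕ)) (x (p.1 - 1))
  have hL (i l : ℕ) : L ((T ^ l) (x i)) =
      if Even i then (T ^ l) (x (i + 1)) else (T ^ (l + 1)) (x (i - 1)) := by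
    by_cases h : l < k i
    · have hi : i < d := by
        by_contra hi
        have := hd i (not_lt.1 hi)
        omega
      have := b.constr_basis K (fun p => if Even (p.1 : ℕ) then (T ^ (p.2 : ℕ)) (x (p.1 + 1))
        else (T ^ (p.2 + 1 : ℕ)) (x (p.1 - 1))) ⟨⟨i, hi⟩, ⟨l, h⟩⟩
      rw [hb] at this
      exact this
    · rw [hzero i l (not_lt.1 h), map_zero]
      split_ifs with he
      · exact (hzero _ _ ((hk (Nat.le_succ i)).trans (not_lt.1 h))).symm
      · obtain ⟨a, rfl⟩ := Nat.not_even_iff_odd.1 he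
        have := hpair a
        rw [hzero _ _ (by rw [Nat.add_sub_cancel]; omega)]
  refine ⟨L, b.ext fun p => ?_⟩
  rw [pow_two, Module.End.mul_apply, hb, hL, ← Module.End.mul_apply, ← pow_succ']
  split_ifs with he
  · rw [hL, if_neg (by rwa [Nat.even_add_one, not_not]), Nat.add_sub_cancel]
  · obtain ⟨a, ha⟩ := Nat.not_even_iff_odd.1 he
    rw [hL, if_pos (by rw [ha]; simp), Nat.sub_add_cancel (by omega)]

open Module in
/-- A nilpotent commutator of square-zero endomorphisms is the square of an endomorphism. -/
theorem exists_sq_eq_of_isNilpotent_commutator {K V : Type*} [Field K] [AddCommGroup V]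
    [Module K V] [FiniteDimensional K V] {M N : End K V} (hM : M * M = 0) (hN : N * N = 0)
    (hT : IsNilpotent (M * N - N * M)) : ∃ L : End K V, L ^ 2 = M * N - N * M := by
  set T := M * N - N * M with hTdef
  obtain ⟨d, k, x, b, hk, hd, hb, hx⟩ := exists_antitone_jordan_chains T hT
  refine exists_sq_eq_of_jordan_chains b hb hx hd hk fun a => ?_
  by_contra! hlt
  have hda : 2 * a < d := by
    by_contra h
    have := hd _ (not_lt.1 h)
    omega
  -- For such `j` exactly the first `2 * a + 1` chains are longer than `j`.
  have hsum (j : ℕ) (h1 : k (2 * a + 1) ≤ j) (h2 : j < k (2 * a)) :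
      ∑ i : Fin d, (k i - j) = ∑ i : Fin d, (k i - (j + 1)) + (2 * a + 1) := by
    have hcard : ∑ i : Fin d, (if (i : ℕ) < 2 * a + 1 then 1 else 0) = 2 * a + 1 := by
      rw [Fin.sum_univ_eq_sum_range (fun i => if i < 2 * a + 1 then 1 else 0) d,
        ← Finset.sum_filter, Finset.sum_const, smul_eq_mul, mul_one]
      rw [show (Finset.range d).filter (· < 2 * a + 1) = Finset.range (2 * a + 1) by
        ext i; simp only [Finset.mem_filter, Finset.mem_range]; omega, Finset.card_range]
    conv_rhs => rw [← hcard, ← Finset.sum_add_distrib]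
    refine Finset.sum_congr rfl fun i _ => ?_
    split_ifs with hi
    · have := hk (show (i : ℕ) ≤ 2 * a by omega)
      omega
    · have := hk (show 2 * a + 1 ≤ (i : ℕ) by omega)
      omega
  have hker := finrank_ker_pow_of_jordan_chains b hb hx
  set j := k (2 * a + 1) with hj
  have h0 := hker j
  have h1 := hker (j + 1)
  have h2 := hker (j + 2)
  have s0 := hsum j le_rfl (by omega)
  have s1 := hsum (j + 1) (by omega) (by omega)
  have := even_finrank_ker_pow_layer hM hN hTdef j (2 * a + 1) (by omega) (by
    rw [show j + 1 + 1 = j + 2 from rfl] at s1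
    omega)
  exact absurd this (by simp)

open Module in
/-- The square of a nilpotent endomorphism is a commutator of square-zero endomorphisms. -/
theorem exists_commutator_eq_sq_of_isNilpotent {K V : Type*} [Field K] [AddCommGroup V]
    [Module K V] [FiniteDimensional K V] {L : End K V} (hL : IsNilpotent L) :
    ∃ M N : End K V, M ^ 2 = 0 ∧ N ^ 2 = 0 ∧ L ^ 2 = M * N - N * M := by
  obtain ⟨d, k, x, b, hb, hx⟩ := exists_jordan_chains L hL
  have hshift (w : ℕ → K) :
      ∃ S : End K V, ∀ i l, S ((L ^ l) (x i)) = w l • (L ^ (l + 1)) (x i) := by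
    refine ⟨b.constr K fun p => w p.2 • (L ^ (p.2 + 1 : ℕ)) (x p.1), fun i l => ?_⟩
    by_cases h : l < k i
    · have := b.constr_basis K (fun p => w p.2 • (L ^ (p.2 + 1 : ℕ)) (x p.1)) ⟨i, ⟨l, h⟩⟩
      rw [hb] at this
      exact this
    · obtain ⟨m, rfl⟩ := Nat.exists_eq_add_of_le (not_lt.1 h)
      have h0 : (L ^ (k i + m)) (x i) = 0 := by
        rw [add_comm, pow_add, Module.End.mul_apply, hx, map_zero]
      rw [pow_succ', Module.End.mul_apply, h0]
      simp
  -- M moves only odd positions and N only even ones, so both square to zero. The signs make `M * N`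
  -- equal to `L ^ 2` at even positions and `N * M` equal to `-L ^ 2` at odd ones.
  obtain ⟨M, hM⟩ := hshift fun l => if Even l then 0 else (-1) ^ (l / 2)
  obtain ⟨N, hN⟩ := hshift fun l => if Even l then (-1) ^ (l / 2) else 0
  refine ⟨M, N, b.ext fun ⟨i, l⟩ => ?_, b.ext fun ⟨i, l⟩ => ?_, b.ext fun ⟨i, l⟩ => ?_⟩
  · rw [pow_two, Module.End.mul_apply, hb, hM, map_smul, hM]
    by_cases h : Even (l : ℕ) <;> simp [h, Nat.even_add_one]
  · rw [pow_two, Module.End.mul_apply, hb, hN, map_smul, hN]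
    by_cases h : Even (l : ℕ) <;> simp [h, Nat.even_add_one]
  · rw [LinearMap.sub_apply, Module.End.mul_apply, Module.End.mul_apply, hb, hM, hN, map_smul,
      map_smul, hM, hN, ← Module.End.mul_apply, ← pow_add, add_comm 2]
    rcases Nat.even_or_odd' (l : ℕ) with ⟨a, h | h⟩
    · rw [h, show (2 * a + 1) / 2 = a by omega, show 2 * a / 2 = a by omega]
      simp [smul_smul, ← mul_pow]
    · rw [h, show (2 * a + 1) / 2 = a by omega, show (2 * a + 1 + 1) / 2 = a + 1 by omega]
      simp [smul_smul, ← mul_pow, pow_succ, Nat.even_add_one]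

/-! ### Transfer to matrices and block sums -/

theorem matrixSimilar_of_linearEquiv {ι κ : Type*} [Fintype ι] [DecidableEq ι] [Fintype κ]
    [DecidableEq κ] {S : Matrix ι ι ℂ} {T : Matrix κ κ ℂ} (e : (κ → ℂ) ≃ₗ[ℂ] (ι → ℂ))
    (h : ∀ v, S.mulVec (e v) = e (T.mulVec v)) : MatrixSimilar S T := by
  refine ⟨LinearMap.toMatrix' e.toLinearMap, LinearMap.toMatrix' e.symm.toLinearMap, ?_, ?_, ?_⟩
  · rw [← LinearMap.toMatrix'_comp, LinearEquiv.comp_symm, LinearMap.toMatrix'_id]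
  · rw [← LinearMap.toMatrix'_comp, LinearEquiv.symm_comp, LinearMap.toMatrix'_id]
  · apply Matrix.toLin'.injective
    apply LinearMap.ext
    intro v
    have := h (e.symm v)
    rw [LinearEquiv.apply_symm_apply] at this
    simp only [Matrix.toLin'_mul, Matrix.toLin'_toMatrix', LinearMap.comp_apply,
      Matrix.toLin'_apply, LinearEquiv.coe_coe]
    exact this

theorem MatrixSimilar.isSquareZeroCommutator {ι κ : Type*} [Fintype ι] [DecidableEq ι] [Fintype κ]
    [DecidableEq κ] {S : Matrix ι ι ℂ} {T : Matrix κ κ ℂ} (h : MatrixSimilar S T)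
    (hT : IsSquareZeroCommutator T) : IsSquareZeroCommutator S := by
  obtain ⟨P, Q, -, hQP, rfl⟩ := h
  obtain ⟨M, N, hM, hN, rfl⟩ := hT
  have key (A B : Matrix κ κ ℂ) : P * A * Q * (P * B * Q) = P * (A * B) * Q := by
    rw [show P * A * Q * (P * B * Q) = P * (A * (Q * P) * B) * Q by simp only [Matrix.mul_assoc],
      hQP, Matrix.mul_one]
  refine ⟨P * M * Q, P * N * Q, ?_, ?_, ?_⟩
  · rw [pow_two, key, ← pow_two, hM, Matrix.mul_zero, Matrix.zero_mul]
  · rw [pow_two, key, ← pow_two, hN, Matrix.mul_zero, Matrix.zero_mul]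
  · rw [key, key, Matrix.mul_sub, Matrix.sub_mul]

theorem IsSquareZeroCommutator.matrixDirectSum {ι κ : Type*} [Fintype ι] [DecidableEq ι]
    [Fintype κ] [DecidableEq κ] {S : Matrix ι ι ℂ} {T : Matrix κ κ ℂ}
    (hS : IsSquareZeroCommutator S) (hT : IsSquareZeroCommutator T) :
    IsSquareZeroCommutator (matrixDirectSum S T) := by
  obtain ⟨M, N, hM, hN, rfl⟩ := hS
  obtain ⟨M', N', hM', hN', rfl⟩ := hT
  rw [pow_two] at hM hN hM' hN'
  refine ⟨Matrix.fromBlocks M 0 0 M', Matrix.fromBlocks N 0 0 N', ?_, ?_, ?_⟩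
  · simp [pow_two, Matrix.fromBlocks_multiply, hM, hM']
  · simp [pow_two, Matrix.fromBlocks_multiply, hN, hN']
  · simp [_root_.matrixDirectSum, Matrix.fromBlocks_multiply, sub_eq_add_neg, Matrix.fromBlocks_neg,
      Matrix.fromBlocks_add]

theorem isSquareZeroCommutator_directSum_neg {ι : Type*} [Fintype ι] [DecidableEq ι]
    (A : Matrix ι ι ℂ) : IsSquareZeroCommutator (matrixDirectSum A (-A)) := by
  refine ⟨Matrix.fromBlocks 0 A 0 0, Matrix.fromBlocks 0 0 1 0, ?_, ?_, ?_⟩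
  · simp [pow_two, Matrix.fromBlocks_multiply]
  · simp [pow_two, Matrix.fromBlocks_multiply]
  · simp [matrixDirectSum, Matrix.fromBlocks_multiply, sub_eq_add_neg, Matrix.fromBlocks_neg,
      Matrix.fromBlocks_add]

theorem isSquareZeroCommutator_sq_of_isNilpotent {ι : Type*} [Fintype ι] [DecidableEq ι]
    {L : Matrix ι ι ℂ} (hL : IsNilpotent L) : IsSquareZeroCommutator (L ^ 2) := by
  obtain ⟨M, N, hM, hN, h⟩ :=
    exists_commutator_eq_sq_of_isNilpotent (hL.map (Matrix.toLinAlgEquiv' (R := ℂ) (n := ι)))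
  refine ⟨Matrix.toLinAlgEquiv'.symm M, Matrix.toLinAlgEquiv'.symm N, ?_, ?_, ?_⟩
  · rw [← map_pow, hM, map_zero]
  · rw [← map_pow, hN, map_zero]
  · rw [← map_mul, ← map_mul, ← map_sub, ← h, ← map_pow, AlgEquiv.symm_apply_apply]

/-! ### Fitting decomposition of `M * N + N * M` -/

-- This kernel is stable under M and N, and `T ^ 2 = E ^ 2` makes the commutator nilpotent on it.
open Module in
theorem exists_nilpotent_sq_eq_commutator_on_ker {K V : Type*} [Field K] [AddCommGroup V]
    [Module K V] [FiniteDimensional K V] {M N : End K V} (hM : M * M = 0) (hN : N * N = 0)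
    (p : ℕ) :
    ∃ l : End K (LinearMap.ker ((M * N + N * M) ^ p)), IsNilpotent l ∧
      ∀ v, ((l (l v) : LinearMap.ker ((M * N + N * M) ^ p)) : V) = (M * N - N * M) (v : V) := by
  set E := M * N + N * M with hE
  set U := LinearMap.ker (E ^ p)
  have hME : Commute M E := by
    rw [Commute, SemiconjBy, hE, mul_add, add_mul, ← mul_assoc, hM, mul_assoc N, hM, mul_assoc]
    simp
  have hNE : Commute N E := by
    rw [Commute, SemiconjBy, hE, mul_add, add_mul, ← mul_assoc N N, hN, mul_assoc M N N, hN,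
      mul_assoc]
    simp
  have hpres {S : End K V} (hS : Commute S E) : ∀ v ∈ U, S v ∈ U := fun v hv => by
    rw [LinearMap.mem_ker, ← Module.End.mul_apply, ← (hS.pow_right p).eq, Module.End.mul_apply,
      LinearMap.mem_ker.1 hv, map_zero]
  let M₀ : End K U := M.restrict (hpres hME)
  let N₀ : End K U := N.restrict (hpres hNE)
  have hM₀ : M₀ * M₀ = 0 := LinearMap.ext fun v => Subtype.ext (LinearMap.congr_fun hM v)
  have hN₀ : N₀ * N₀ = 0 := LinearMap.ext fun v => Subtype.ext (LinearMap.congr_fun hN v)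
  set T₀ := M₀ * N₀ - N₀ * M₀ with hT₀
  have hT (v : U) : (T₀ v : V) = (M * N - N * M) (v : V) := rfl
  have hsq : (M * N - N * M) ^ 2 = E ^ 2 := by
    rw [hE, pow_two, pow_two]
    simp only [mul_add, add_mul, mul_sub, sub_mul, mul_assoc]
    simp only [← mul_assoc N N, ← mul_assoc M M, hM, hN]
    simp
  have hpow (j : ℕ) (v : U) : ((T₀ ^ j) v : V) = ((M * N - N * M) ^ j) (v : V) := by
    induction j with
    | zero => rfl
    | succ j ih => rw [pow_succ', pow_succ', Module.End.mul_apply, Module.End.mul_apply, hT, ih]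
  have hnil : IsNilpotent T₀ := by
    refine ⟨2 * p, LinearMap.ext fun v => Subtype.ext ?_⟩
    rw [hpow, pow_mul, hsq, ← pow_mul, mul_comm, pow_mul, pow_two, Module.End.mul_apply,
      LinearMap.mem_ker.1 v.2, map_zero]
    rfl
  obtain ⟨l, hl⟩ := exists_sq_eq_of_isNilpotent_commutator hM₀ hN₀ hnil
  refine ⟨l, (IsNilpotent.pow_iff_pos two_ne_zero).1 (hl ▸ hnil), fun v => ?_⟩
  rw [← hT, hT₀, ← hl, pow_two]
  rfl

open Module in
theorem exists_decomposition_of_commutator {V : Type*} [AddCommGroup V] [Module ℂ V]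
    [FiniteDimensional ℂ V] {M N : End ℂ V} (hM : M * M = 0) (hN : N * N = 0) :
    ∃ (k m : ℕ) (A : End ℂ (Fin k → ℂ)) (L : End ℂ (Fin m → ℂ))
      (e : (((Fin k → ℂ) × (Fin k → ℂ)) × (Fin m → ℂ)) ≃ₗ[ℂ] V), IsUnit A ∧ IsNilpotent L ∧
        ∀ a b c, (M * N - N * M) (e ((a, b), c)) = e ((A a, -A b), (L ^ 2) c) := by
  set T := M * N - N * M with hT
  set E := M * N + N * M with hE
  set X := M + N with hX
  have hXX : X * X = E := by
    rw [hX, hE, mul_add, add_mul, add_mul, hM, hN]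
    abel
  have hTX : T * X = -(X * T) := by
    rw [hX, mul_add, add_mul, hT, mul_commutator_of_sq_eq_zero hM, commutator_mul_of_sq_eq_zero hN]
    abel
  have hXE : X * E = E * X := by rw [← hXX, mul_assoc]
  have hTE : T * E = E * T := by
    rw [← hXX, ← mul_assoc, hTX, neg_mul, mul_assoc, hTX, mul_neg, neg_neg, mul_assoc]
  have hsq : T * T = E * E := by
    rw [hT, hE]
    simp only [mul_add, add_mul, mul_sub, sub_mul, mul_assoc]
    simp only [← mul_assoc N N, ← mul_assoc M M, hM, hN]
    simp
  have hXX' (v : V) : X (X v) = E v := LinearMap.congr_fun hXX v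
  have hTX' (v : V) : T (X v) = -X (T v) := LinearMap.congr_fun hTX v
  have hXE' (v : V) : X (E v) = E (X v) := LinearMap.congr_fun hXE v
  have hTE' (v : V) : T (E v) = E (T v) := LinearMap.congr_fun hTE v
  have hsq' (v : V) : T (T v) = E (E v) := LinearMap.congr_fun hsq v
  -- The bound `1 ≤ p` puts `ker E` inside `ker (E ^ p)`, so E is injective on W.
  obtain ⟨p, hcompl, hp⟩ := (E.eventually_isCompl_ker_pow_range_pow.and
    (Filter.eventually_ge_atTop 1)).exists
  set U := LinearMap.ker (E ^ p) with hU
  set W := LinearMap.range (E ^ p) with hW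
  obtain ⟨l, hl, hlT⟩ : ∃ l : End ℂ U, IsNilpotent l ∧ ∀ v, ((l (l v) : U) : V) = T v :=
    exists_nilpotent_sq_eq_commutator_on_ker hM hN p
  have hWpres {S : End ℂ V} (hS : S * E = E * S) : ∀ v ∈ W, S v ∈ W := by
    rintro _ ⟨u, rfl⟩
    exact ⟨S u, LinearMap.congr_fun ((show Commute S E from hS).pow_right p).eq.symm u⟩
  have hWT := hWpres hTE
  have hWE := hWpres (S := E) rfl
  have hWX := hWpres hXE
  have hinj (v : V) (hv : v ∈ W) (h : E v = 0) : v = 0 := by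
    refine Submodule.disjoint_def.1 hcompl.disjoint v ?_ hv
    obtain ⟨q, rfl⟩ := Nat.exists_eq_add_of_le' hp
    rw [hU, LinearMap.mem_ker, pow_succ, Module.End.mul_apply, h, map_zero]
  have hsurj (v : V) (hv : v ∈ W) : ∃ w ∈ W, E w = v := by
    have h := LinearMap.surjective_of_injective (f := E.restrict hWE) (by
      rw [← LinearMap.ker_eq_bot, LinearMap.ker_eq_bot']
      exact fun w hw => Subtype.ext (hinj w w.2 (congrArg Subtype.val hw)))
    obtain ⟨w, hw⟩ := h ⟨v, hv⟩
    exact ⟨w, w.2, congrArg Subtype.val hw⟩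
  let P : Submodule ℂ V := W ⊓ LinearMap.ker (T - E)
  have hP (v : V) : v ∈ P ↔ v ∈ W ∧ T v = E v := by
    simp [P, LinearMap.mem_ker, sub_eq_zero]
  have hPE : ∀ v ∈ P, E v ∈ P := fun v hv => by
    rw [hP] at hv ⊢
    exact ⟨hWE v hv.1, by rw [hTE', hv.2]⟩
  have hPinj : Function.Injective (E.restrict hPE) := by
    rw [← LinearMap.ker_eq_bot, LinearMap.ker_eq_bot']
    exact fun w hw => Subtype.ext (hinj w ((hP w).1 w.2).1 (congrArg Subtype.val hw))
  let φ : (Fin (finrank ℂ P) → ℂ) ≃ₗ[ℂ] P := (finBasis ℂ P).equivFun.symm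
  let ψ : (Fin (finrank ℂ U) → ℂ) ≃ₗ[ℂ] U := (finBasis ℂ U).equivFun.symm
  let A : End ℂ (Fin (finrank ℂ P) → ℂ) := φ.symm.conj (E.restrict hPE)
  let L : End ℂ (Fin (finrank ℂ U) → ℂ) := ψ.symm.conj l
  have hA (a) : (φ (A a) : V) = E (φ a) := by
    simp [A, LinearEquiv.conj_apply]
  have hL (c) : (ψ ((L ^ 2) c) : V) = T (ψ c) := by
    rw [← hlT]
    simp [L, LinearEquiv.conj_apply, pow_two]
  -- X carries P onto the part of W where `T = -E`; using the coordinates of P for both copies makes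
  -- T act as A and -A.
  let F : (((Fin (finrank ℂ P) → ℂ) × (Fin (finrank ℂ P) → ℂ)) × (Fin (finrank ℂ U) → ℂ)) →ₗ[ℂ] V :=
    ((P.subtype ∘ₗ φ.toLinearMap).coprod (X ∘ₗ P.subtype ∘ₗ φ.toLinearMap)).coprod
      (U.subtype ∘ₗ ψ.toLinearMap)
  have hF (a b c) : F ((a, b), c) = φ a + X (φ b) + ψ c := rfl
  have hφ (a) := (hP (φ a)).1 (φ a).2
  have hFinj : Function.Injective F := by
    rw [← LinearMap.ker_eq_bot, LinearMap.ker_eq_bot']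
    rintro ⟨⟨a, b⟩, c⟩ h
    rw [hF] at h
    have hab : (φ a : V) + X (φ b) ∈ W := add_mem (hφ a).1 (hWX _ (hφ b).1)
    have hc : (ψ c : V) = 0 := by
      refine Submodule.disjoint_def.1 hcompl.disjoint _ (ψ c).2 ?_
      rw [eq_neg_of_add_eq_zero_right h]
      exact neg_mem hab
    rw [hc, add_zero] at h
    have h2 : T ((φ a : V) + X (φ b)) = 0 := by rw [h, map_zero]
    have h3 : E ((φ a : V) + X (φ b)) = 0 := by rw [h, map_zero]
    rw [map_add, hTX', (hφ a).2, (hφ b).2, hXE'] at h2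
    rw [map_add] at h3
    have ha : (φ a : V) = 0 := by
      refine hinj _ (hφ a).1 ?_
      have h4 : (2 : ℂ) • E (φ a) = 0 := by
        rw [two_smul]
        calc E (φ a) + E (φ a) = (E (φ a) + -E (X (φ b))) + (E (φ a) + E (X (φ b))) := by abel
          _ = 0 := by rw [h2, h3, add_zero]
      exact (smul_eq_zero.1 h4).resolve_left two_ne_zero
    rw [ha, zero_add] at h
    have hb : (φ b : V) = 0 := by
      refine hinj _ (hφ b).1 ?_
      rw [← hXX', h, map_zero]
    have ha' : a = 0 := φ.map_eq_zero_iff.1 (Subtype.ext ha)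
    have hb' : b = 0 := φ.map_eq_zero_iff.1 (Subtype.ext hb)
    have hc' : c = 0 := ψ.map_eq_zero_iff.1 (Subtype.ext hc)
    rw [ha', hb', hc']
    rfl
  have hFsurj : Function.Surjective F := by
    intro v
    obtain ⟨u, hu, w, hw, rfl⟩ := Submodule.mem_sup.1
      (hcompl.sup_eq_top ▸ Submodule.mem_top : v ∈ U ⊔ W)
    obtain ⟨w₁, hw₁, rfl⟩ := hsurj w hw
    obtain ⟨w₂, hw₂, rfl⟩ := hsurj w₁ hw₁
    -- With `w = E (E w₂)`, the projections of `w` are the halves of `w ± T (E w₂)`; the second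
    -- vector is X applied to half of `w - T (E w₂)` after E is cancelled through `X ^ 2 = E`.
    have ha : (2⁻¹ : ℂ) • (E (E w₂) + T (E w₂)) ∈ P := by
      refine P.smul_mem _ ((hP _).2 ⟨add_mem hw (hWT _ hw₁), ?_⟩)
      rw [map_add, map_add, hsq', hTE', add_comm]
    have hb : (2⁻¹ : ℂ) • X (E w₂ - T w₂) ∈ P := by
      refine P.smul_mem _ ((hP _).2 ⟨hWX _ (sub_mem hw₁ (hWT _ hw₂)), ?_⟩)
      rw [hTX', ← hXE', ← map_neg, map_sub, map_sub, hsq', hTE', neg_sub]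
    refine ⟨((φ.symm ⟨_, ha⟩, φ.symm ⟨_, hb⟩), ψ.symm ⟨u, hu⟩), ?_⟩
    rw [hF, φ.apply_symm_apply, φ.apply_symm_apply, ψ.apply_symm_apply]
    simp only [map_smul, hXX', map_sub, hTE']
    module
  refine ⟨_, _, A, L, LinearEquiv.ofBijective F ⟨hFinj, hFsurj⟩, ?_, ?_, fun a b c => ?_⟩
  · rw [Module.End.isUnit_iff]
    have : Function.Injective A := by
      simp only [A, LinearEquiv.conj_apply]
      simpa using hPinj
    exact ⟨this, LinearMap.surjective_of_injective this⟩
  · exact hl.map (ψ.symm.conjAlgEquiv ℂ)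
  · change T (F _) = F _
    rw [hF, hF, map_add, map_add,
      hTX', (hφ a).2, (hφ b).2, hL, hA, map_neg, Submodule.coe_neg, hA, map_neg]

theorem theorem3p17 (n : ℕ) (hn : 2 ≤ n) (T : Matrix (Fin n) (Fin n) ℂ) :
    IsSquareZeroCommutator T ↔
      ∃ k : ℕ, 2 * k ≤ n ∧
        ∃ (A : Matrix (Fin k) (Fin k) ℂ) (L : Matrix (Fin (n - 2 * k)) (Fin (n - 2 * k)) ℂ),
          IsUnit A ∧ IsNilpotent L ∧
            MatrixSimilar T (matrixDirectSum (matrixDirectSum A (-A)) (L ^ 2)) := by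
  constructor
  · rintro ⟨M, N, hM, hN, rfl⟩
    let Φ := Matrix.toLinAlgEquiv' (R := ℂ) (n := Fin n)
    obtain ⟨k, m, A, L, e, hA, hL, h⟩ := exists_decomposition_of_commutator (M := Φ M) (N := Φ N)
      (by rw [← map_mul, ← pow_two, hM, map_zero]) (by rw [← map_mul, ← pow_two, hN, map_zero])
    have hdim : k + k + m = n := by simpa using e.finrank_eq
    obtain rfl : m = n - 2 * k := by omega
    obtain ⟨A, rfl⟩ := (Matrix.toLinAlgEquiv' (R := ℂ)).surjective A
    obtain ⟨L, rfl⟩ := (Matrix.toLinAlgEquiv' (R := ℂ)).surjective L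
    refine ⟨k, by omega, A, L, (MulEquiv.isUnit_map _).1 hA,
      (IsNilpotent.map_iff Matrix.toLinAlgEquiv'.injective).1 hL, matrixSimilar_of_linearEquiv
        ((LinearEquiv.sumArrowLequivProdArrow (Fin k ⊕ Fin k) (Fin (n - 2 * k)) ℂ ℂ).trans
          (((LinearEquiv.sumArrowLequivProdArrow (Fin k) (Fin k) ℂ ℂ).prodCongr
            (LinearEquiv.refl ℂ _)).trans e)) fun v => ?_⟩
    have h' := h (fun i => v (.inl (.inl i))) (fun i => v (.inl (.inr i))) (fun i => v (.inr i))
    rw [← map_mul, ← map_mul, ← map_sub] at h'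
    refine Eq.trans h' ?_
    refine congrArg e (Prod.ext (Prod.ext (funext fun i => ?_) (funext fun i => ?_))
      (funext fun i => ?_))
    · change A.mulVec _ i = (matrixDirectSum _ _).mulVec v (.inl (.inl i))
      simp [matrixDirectSum, Matrix.fromBlocks_mulVec, Function.comp_def]
    · change -A.mulVec _ i = (matrixDirectSum _ _).mulVec v (.inl (.inr i))
      simp [matrixDirectSum, Matrix.fromBlocks_mulVec, Function.comp_def, Matrix.neg_mulVec]
    · rw [← map_pow]
      change (L ^ 2).mulVec _ i = (matrixDirectSum _ _).mulVec v (.inr i)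
      simp [matrixDirectSum, Matrix.fromBlocks_mulVec, Function.comp_def]
  · rintro ⟨k, -, A, L, -, hL, h⟩
    exact h.isSquareZeroCommutator ((isSquareZeroCommutator_directSum_neg A).matrixDirectSum
      (isSquareZeroCommutator_sq_of_isNilpotent hL))
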